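/- Let $\mathbb F$ be a finite field of odd characteristic, let $\widehat\tau:\mathbb F\to\mathbb C^1$ be a non-trivial additive character with values in the group $\mathbb C^1$ of complex numbers of absolute value one, and let $\overline\beta\in M_n(\mathbb F)$ be regular, i.e. its minimal polynomial equals its characteristic polynomial. Assume that the characteristic polynomial of $\overline\beta$ is separable. Put $\mathbb V_\beta=M_n(\mathbb F)/\mathbb F[\overline\beta]$, a symplectic space with the form $\langle\dot X,\dot Y\rangle=\mathrm{tr}((XY-YX)\overline\beta)$. Let $Sp(\mathbb V_\beta)$ be its isometry group, acting on $\mathbb V_\beta$ from the right, and for $\varepsilon\in\mathbb F[\overline\beta]^\times$ let $\sigma_\varepsilon\in Sp(\mathbb V_\beta)$ be $v\mapsto\varepsilon^{-1}v\varepsilon$. Let $H(\mathbb V_\beta)=\mathbb V_\beta\times\mathbb C^1$ be the Heisenberg group, with $(u,s)(v,t)=(u+v,\ st\,\widehat\tau(2^{-1}\langle u,v\rangle))$. (The cocycle $c_T$.) A Schrödinger representation is an irreducible complex representation $\pi$ of $H(\mathbb V_\beta)$ with $\pi(0,s)=s$ for all $s\in\mathbb C^1$. Given $\pi$ on a space $H_\pi$,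 choose for each $\sigma\in Sp(\mathbb V_\beta)$ some $T(\sigma)\in GL_{\mathbb C}(H_\pi)$ with $\pi(u\sigma,s)=T(\sigma)^{-1}\circ\pi(u,s)\circ T(\sigma)$ for all $(u,s)$, and define $c_T(\sigma,\sigma')\in\mathbb C^\times$ by $T(\sigma)\circ T(\sigma')=c_T(\sigma,\sigma')\,T(\sigma\sigma')$. For $\varepsilon,\eta\in\mathbb F[\overline\beta]^\times$ put $c_T(\varepsilon,\eta)=c_T(\sigma_\varepsilon,\sigma_\eta)$. (The cocycle $c_{\overline\beta,\rho}$.) Let $\rho$ be an additive character of $\mathbb F[\overline\beta]$, and let $v\mapsto[v]$ be an $\mathbb F$-linear section of $M_n(\mathbb F)\to\mathbb V_\beta$. For $\varepsilon\in\mathbb F[\overline\beta]^\times$ and $v\in\mathbb V_\beta$ put $\gamma(v,\varepsilon)=\varepsilon^{-1}[v]\varepsilon-[\varepsilon^{-1}v\varepsilon]\in\mathbb F[\overline\beta]$, let $v_\varepsilon\in\mathbb V_\beta$ be determined by $\rho(\gamma(v,\varepsilon))=\widehat\tau(\langle v,v_\varepsilon\rangle)$ for all $v\in\mathbb V_\beta$,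 and put $c_{\overline\beta,\rho}(\varepsilon,\eta)=\widehat\tau(2^{-1}\langle v_\varepsilon,v_{\varepsilon\eta}\rangle)$. Then these objects are well defined: a Schrödinger representation exists; for every Schrödinger representation a family $T$ exists; for every such $T$ there is a unique $c_T$; and for all $\rho$ and $[\cdot]$ there is a unique family $(v_\varepsilon)_\varepsilon$. Moreover, for every additive character $\rho$ of $\mathbb F[\overline\beta]$, and for every choice of $[\cdot]$, $\pi$ and $T$, the function $c_{\overline\beta,\rho}\cdot c_T$ is a 2-cocycle of $\mathbb F[\overline\beta]^\times$ in $\mathbb C^\times$ (with trivial action), and its class $[c_{\overline\beta,\rho}\,c_T]\in H^2(\mathbb F[\overline\beta]^\times,\mathbb C^\times)$ is trivial. -/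

import Mathlib

open groupCohomology

namespace SchurMultiplier

noncomputable section

universe u w

section Heisenberg

variable {F : Type u} [Field F] {V : Type u} [AddCommGroup V] [Module F V]

/-- The Heisenberg group `V × ℂ¹` attached to a bilinear form `B` on `V` and an additive
character `τ` of `F`. -/
@[ext]
structure Heisenberg (τ : AddChar F Circle) (B : LinearMap.BilinForm F V) where
  fst : V
  snd : Circle

namespace Heisenberg

variable (τ : AddChar F Circle) (B : LinearMap.BilinForm F V)

/-- `(u, s) (v, t) = (u + v, s t τ(2⁻¹ ⟨u, v⟩))`. -/
instance : Mul (Heisenberg τ B) :=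
  ⟨fun x y => ⟨x.fst + y.fst, x.snd * y.snd * τ (2⁻¹ * B x.fst y.fst)⟩⟩

instance : One (Heisenberg τ B) := ⟨⟨0, 1⟩⟩

instance : Inv (Heisenberg τ B) :=
  ⟨fun x => ⟨-x.fst, x.snd⁻¹ * τ (2⁻¹ * B x.fst x.fst)⟩⟩

theorem heis_aux (a b c x y z : Circle) :
    a * b * x * c * (y * z) = a * (b * c * z) * (x * y) := by
  ac_rfl

instance : Group (Heisenberg τ B) :=
  Group.ofLeftAxioms
    (by
      intro x y z
      ext1
      · exact add_assoc _ _ _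
      · change x.snd * y.snd * τ (2⁻¹ * B x.fst y.fst) * z.snd *
            τ (2⁻¹ * B (x.fst + y.fst) z.fst) =
          x.snd * (y.snd * z.snd * τ (2⁻¹ * B y.fst z.fst)) *
            τ (2⁻¹ * B x.fst (y.fst + z.fst))
        simp only [map_add, LinearMap.add_apply, mul_add, AddChar.map_add_eq_mul]
        exact heis_aux _ _ _ _ _ _)
    (by
      intro x
      ext1
      · exact zero_add _
      · change 1 * x.snd * τ (2⁻¹ * B 0 x.fst) = x.snd
        simp)
    (by
      intro x
      ext1
      · exact neg_add_cancel _
      · change x.snd⁻¹ * τ (2⁻¹ * B x.fst x.fst) * x.snd * τ (2⁻¹ * B (-x.fst) x.fst) = 1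
        simp only [map_neg, LinearMap.neg_apply, mul_neg, AddChar.map_neg_eq_inv]
        rw [mul_comm x.snd⁻¹, mul_assoc (τ _), inv_mul_cancel, mul_one, mul_inv_cancel])

end Heisenberg

variable {τ : AddChar F Circle} {B : LinearMap.BilinForm F V}
variable {H : Type w} [AddCommGroup H] [Module ℂ H]

/-- `π` is a Schrödinger representation of the Heisenberg group: it is irreducible and
`π (0, s)` is multiplication by `s`. -/
structure IsSchrodinger (π : Representation ℂ (Heisenberg τ B) H) : Prop where
  irreducible : π.IsIrreducible
  central : ∀ (s : Circle) (x : H), π ⟨0, s⟩ x = (s : ℂ) • x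

/-- The group of linear automorphisms of `V` that preserve the form `B`.  The automorphisms act
on `V` from the right in the text, so that the product of `σ` and `σ'` there is `σ' * σ` here. -/
def Sp (B : LinearMap.BilinForm F V) : Subgroup (V ≃ₗ[F] V) where
  carrier := {σ | ∀ u v, B (σ u) (σ v) = B u v}
  one_mem' := fun _ _ => rfl
  mul_mem' := fun {σ σ'} h h' u v => (h (σ' u) (σ' v)).trans (h' u v)
  inv_mem' := fun {σ} h u v => by
    rw [← h (σ⁻¹ u) (σ⁻¹ v)]
    exact congrArg₂ (fun a b => B a b) (σ.apply_symm_apply u) (σ.apply_symm_apply v)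

/-- `π (uσ, s) = T(σ)⁻¹ ∘ π (u, s) ∘ T(σ)` for all `σ ∈ Sp(V)` and all `(u, s)`. -/
def IsWeilFamily (π : Representation ℂ (Heisenberg τ B) H) (T : Sp B → (H ≃ₗ[ℂ] H)) : Prop :=
  ∀ (σ : Sp B) (u : V) (s : Circle) (x : H),
    π ⟨σ.1 u, s⟩ x = (T σ).symm (π ⟨u, s⟩ (T σ x))

/-- `T(σ) ∘ T(σ') = c(σ, σ') T(σσ')`, where `σσ'` is the product for the right action. -/
def IsFactorSet (T : Sp B → (H ≃ₗ[ℂ] H)) (c : Sp B → Sp B → ℂˣ) : Prop :=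
  ∀ (σ σ' : Sp B) (x : H), T σ (T σ' x) = (c σ σ' : ℂ) • T (σ' * σ) x

end Heisenberg

section Matrices

variable {F : Type u} [Field F] {n : ℕ} (β : Matrix (Fin n) (Fin n) F)

/-- The commutative subalgebra `F[β]` of `M_n(F)`. -/
abbrev Alg : Subalgebra F (Matrix (Fin n) (Fin n) F) := Algebra.adjoin F {β}

/-- `V_β = M_n(F) / F[β]`. -/
abbrev VBeta : Type u := Matrix (Fin n) (Fin n) F ⧸ Subalgebra.toSubmodule (Alg β)

/-- The quotient map `M_n(F) → V_β`. -/
abbrev toV : Matrix (Fin n) (Fin n) F →ₗ[F] VBeta β := (Subalgebra.toSubmodule (Alg β)).mkQ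

theorem commute_of_mem {X : Matrix (Fin n) (Fin n) F} (hX : X ∈ Alg β)
    {Y : Matrix (Fin n) (Fin n) F} (hY : Y ∈ Alg β) : X * Y = Y * X :=
  congrArg Subtype.val ((Algebra.isMulCommutative_adjoin F (s := {β})
    (by simp only [Set.mem_singleton_iff]; rintro _ rfl _ rfl; rfl)).is_comm.comm
      (⟨X, hX⟩ : Alg β) ⟨Y, hY⟩)

/-- `(X, Y) ↦ tr ((XY - YX) β)` on `M_n(F)`. -/
def matrixForm : LinearMap.BilinForm F (Matrix (Fin n) (Fin n) F) :=
  LinearMap.mk₂ F (fun X Y => ((X * Y - Y * X) * β).trace)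
    (by intros; simp [add_mul, mul_add, sub_mul]; ring)
    (by intros; simp [sub_mul, mul_sub])
    (by intros; simp [add_mul, mul_add, sub_mul]; ring)
    (by intros; simp [sub_mul, mul_sub])

theorem matrixForm_apply (X Y : Matrix (Fin n) (Fin n) F) :
    matrixForm β X Y = ((X * Y - Y * X) * β).trace := rfl

theorem matrixForm_eq_zero {X : Matrix (Fin n) (Fin n) F} (hX : X ∈ Alg β)
    (Y : Matrix (Fin n) (Fin n) F) : matrixForm β X Y = 0 := by
  have h := commute_of_mem β hX (Algebra.self_mem_adjoin_singleton F β)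
  rw [matrixForm_apply, sub_mul, Matrix.trace_sub, mul_assoc X Y β, Matrix.trace_mul_comm X,
    mul_assoc Y β X, mul_assoc Y X β, h, sub_self]

theorem matrixForm_neg (X Y : Matrix (Fin n) (Fin n) F) :
    matrixForm β Y X = -matrixForm β X Y := by
  rw [matrixForm_apply, matrixForm_apply, ← Matrix.trace_neg, ← neg_mul, neg_sub]

/-- The symplectic form on `V_β` induced by `tr ((XY - YX) β)`. -/
def form : LinearMap.BilinForm F (VBeta β) :=
  (matrixForm β).liftQ₂ (Subalgebra.toSubmodule (Alg β)) (Subalgebra.toSubmodule (Alg β))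
    (fun _ hX => LinearMap.ext fun Y => matrixForm_eq_zero β hX Y)
    (fun _ hX => LinearMap.ext fun Y => by
      rw [LinearMap.flip_apply, matrixForm_neg, matrixForm_eq_zero β hX, neg_zero,
        LinearMap.zero_apply])

theorem form_toV (X Y : Matrix (Fin n) (Fin n) F) :
    form β (toV β X) (toV β Y) = ((X * Y - Y * X) * β).trace := rfl

variable {β}

theorem val_mul_inv (ε : (Alg β)ˣ) :
    ((ε : Alg β) : Matrix (Fin n) (Fin n) F) * ((ε⁻¹ : (Alg β)ˣ) : Alg β) = 1 :=
  congrArg Subtype.val ε.mul_inv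

theorem inv_mul_val (ε : (Alg β)ˣ) :
    (((ε⁻¹ : (Alg β)ˣ) : Alg β) : Matrix (Fin n) (Fin n) F) * (ε : Alg β) = 1 :=
  congrArg Subtype.val ε.inv_mul

/-- `X ↦ ε⁻¹ X ε` on `M_n(F)`. -/
def conj (ε : (Alg β)ˣ) : Matrix (Fin n) (Fin n) F ≃ₗ[F] Matrix (Fin n) (Fin n) F where
  toFun X := ((ε⁻¹ : (Alg β)ˣ) : Alg β) * X * (ε : Alg β)
  map_add' X Y := by rw [mul_add, add_mul]
  map_smul' a X := by rw [mul_smul_comm, smul_mul_assoc, RingHom.id_apply]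
  invFun X := (ε : Alg β) * X * ((ε⁻¹ : (Alg β)ˣ) : Alg β)
  left_inv X := by
    simp only [mul_assoc, val_mul_inv, mul_one]
    rw [← mul_assoc, val_mul_inv, one_mul]
  right_inv X := by
    simp only [mul_assoc, inv_mul_val, mul_one]
    rw [← mul_assoc, inv_mul_val, one_mul]

theorem conj_apply (ε : (Alg β)ˣ) (X : Matrix (Fin n) (Fin n) F) :
    conj ε X = ((ε⁻¹ : (Alg β)ˣ) : Alg β) * X * (ε : Alg β) := rfl

theorem conj_of_mem (ε : (Alg β)ˣ) {X : Matrix (Fin n) (Fin n) F} (hX : X ∈ Alg β) :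
    conj ε X = X := by
  rw [conj_apply, mul_assoc, commute_of_mem β hX (ε : Alg β).2, ← mul_assoc, inv_mul_val, one_mul]

theorem conj_mul (ε : (Alg β)ˣ) (A B : Matrix (Fin n) (Fin n) F) :
    conj ε A * conj ε B = conj ε (A * B) := by
  simp only [conj_apply, mul_assoc]
  rw [← mul_assoc ((ε : Alg β) : Matrix (Fin n) (Fin n) F), val_mul_inv, one_mul]

theorem trace_conj_mul (ε : (Alg β)ˣ) (A : Matrix (Fin n) (Fin n) F) :
    (conj ε A * β).trace = (A * β).trace := by
  have h := conj_mul ε A β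
  rw [conj_of_mem ε (Algebra.self_mem_adjoin_singleton F β)] at h
  rw [h, conj_apply, Matrix.trace_mul_comm, ← mul_assoc, val_mul_inv, one_mul]

/-- The automorphism `v ↦ ε⁻¹ v ε` of `V_β`. -/
def sigmaEquiv (ε : (Alg β)ˣ) : VBeta β ≃ₗ[F] VBeta β :=
  Submodule.Quotient.equiv (Subalgebra.toSubmodule (Alg β)) (Subalgebra.toSubmodule (Alg β)) (conj ε) (by
    ext X
    constructor
    · rintro ⟨Y, hY, rfl⟩
      change conj ε Y ∈ Alg β
      rw [conj_of_mem ε hY]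
      exact hY
    · intro hX
      exact ⟨X, hX, conj_of_mem ε hX⟩)

theorem sigmaEquiv_toV (ε : (Alg β)ˣ) (X : Matrix (Fin n) (Fin n) F) :
    sigmaEquiv ε (toV β X) = toV β (conj ε X) := rfl

/-- The element `σ_ε : v ↦ ε⁻¹ v ε` of `Sp(V_β)`. -/
def sigma (ε : (Alg β)ˣ) : Sp (form β) :=
  ⟨sigmaEquiv ε, by
    intro u v
    obtain ⟨X, rfl⟩ := Submodule.mkQ_surjective _ u
    obtain ⟨Y, rfl⟩ := Submodule.mkQ_surjective _ v
    rw [sigmaEquiv_toV, sigmaEquiv_toV, form_toV, form_toV, conj_mul, conj_mul, ← map_sub,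
      trace_conj_mul]⟩

/-- A linear splitting `v ↦ [v]` of `0 → F[β] → M_n(F) → V_β → 0`. -/
def IsSplitting (s : VBeta β →ₗ[F] Matrix (Fin n) (Fin n) F) : Prop :=
  ∀ v, toV β (s v) = v

/-- `γ(v, ε) = ε⁻¹ [v] ε - [ε⁻¹ v ε] ∈ F[β]`, for the splitting `v ↦ [v] = s v`. -/
def gamma (s : VBeta β →ₗ[F] Matrix (Fin n) (Fin n) F) (hs : IsSplitting s) (v : VBeta β)
    (ε : (Alg β)ˣ) : Alg β :=
  ⟨((ε⁻¹ : (Alg β)ˣ) : Alg β) * s v * (ε : Alg β) - s ((sigma ε).1 v), by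
    have h : toV β (conj ε (s v) - s (sigmaEquiv ε v)) = 0 := by
      rw [map_sub, hs, ← sigmaEquiv_toV, hs, sub_self]
    exact (Submodule.Quotient.mk_eq_zero _).1 h⟩

/-- The family `(v_ε)` satisfies `ρ(γ(v, ε)) = τ(⟨v, v_ε⟩)` for all `v` and `ε`. -/
def IsDisplacement (τ : AddChar F Circle) (ρ : AddChar (Alg β) ℂ)
    (s : VBeta β →ₗ[F] Matrix (Fin n) (Fin n) F) (hs : IsSplitting s) (d : (Alg β)ˣ → VBeta β) : Prop :=
  ∀ (ε : (Alg β)ˣ) (v : VBeta β), ρ (gamma s hs v ε) = (τ (form β v (d ε)) : ℂ)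

/-- `c_{β,ρ}(ε, η) = τ(2⁻¹ ⟨v_ε, v_{εη}⟩)`, for the family `v_ε = d ε`. -/
def cocycleRho (τ : AddChar F Circle) (d : (Alg β)ˣ → VBeta β) (ε η : (Alg β)ˣ) : ℂˣ :=
  Circle.toUnits (τ (2⁻¹ * form β (d ε) (d (ε * η))))

end Matrices

section Cohomology

variable (G : Type u) [Group G]

/-- `ℂˣ`, written additively, with the trivial action of `G`. -/
abbrev trivialUnits : Rep (ULift.{u} ℤ) G :=
  Rep.trivial (ULift.{u} ℤ) G (ULift.{u} (Additive ℂˣ))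

variable {G}

/-- `c` is a 2-cocycle of `G` in `ℂˣ` (trivial action) and its class in `H²(G, ℂˣ)` is trivial. -/
def IsTrivialClass (c : G → G → ℂˣ) : Prop :=
  ∃ h : (fun p : G × G => ULift.up (Additive.ofMul (c p.1 p.2))) ∈ cocycles₂ (trivialUnits G),
    H2π (trivialUnits G) ⟨_, h⟩ = 0

end Cohomology

end

end SchurMultiplier

open SchurMultiplier

/-! Both factors are coboundaries, and so is their product. For `c_T` this already holds on the
whole symplectic group. With `d = dim H`, the parity operator `d⁻¹ ∑ π(v, 1)` commutes with every `T
σ`, because `σ` permutes `V`. It is an involution because `d² = |V|`, and its trace is `1`, so its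
eigenspaces have dimensions `m + 1` and `m`. Determinants of `T σ` on them trivialise `c_T ^ (m +
1)` and `c_T ^ m`, and their quotient trivialises `c_T` (`IsSchrodinger.exists_coboundary`). For
`c_{β,ρ}`, the map `ε ↦ v_ε` is a 1-cocycle in `V_β`. Separability makes `F[β]` reduced, so `F[β]ˣ`
has order prime to the characteristic, and averaging gives `v_ε = w - σ_ε⁻¹ w`
(`IsDisplacement.exists_eq_sub`). Expanding the form then exhibits a cochain. Regularity enters
through the centraliser of `β`, which is `F[β]`; this makes the form on `V_β` nondegenerate.
Existence and uniqueness of the `T σ` up to scalars is Stone–von Neumann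
(`IsSchrodinger.exists_equiv`) together with Schur's lemma. -/

namespace SchurMultiplier

noncomputable section

universe u w w'

/-! ### Characters of `V` coming from the pairing -/

section Heisenberg

variable {F : Type u} [Field F] {V : Type u} [AddCommGroup V] [Module F V]
variable {τ : AddChar F Circle} {B : LinearMap.BilinForm F V}

/-- The additive character `u ↦ τ(⟨u, v⟩)` of `V`. -/
def pairingChar (τ : AddChar F Circle) (B : LinearMap.BilinForm F V) (v : V) : AddChar V ℂ where
  toFun u := (τ (B u v) : ℂ)
  map_zero_eq_one' := by simp
  map_add_eq_mul' a b := by simp [AddChar.map_add_eq_mul]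

theorem pairingChar_apply (u v : V) : pairingChar τ B v u = (τ (B u v) : ℂ) := rfl

theorem pairingChar_sub (v w : V) :
    pairingChar τ B (v - w) = pairingChar τ B v * (pairingChar τ B w)⁻¹ := by
  ext u
  simp [pairingChar_apply, AddChar.inv_apply, sub_eq_add_neg, AddChar.map_add_eq_mul]

theorem pairingChar_eq_one (hτ : τ ≠ 1) (hB : ∀ v, (∀ u, B u v = 0) → v = 0) {v : V}
    (h : pairingChar τ B v = 1) : v = 0 := by
  refine hB v fun u => ?_
  by_contra hu
  refine hτ (DFunLike.ext _ _ fun a => ?_)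
  -- Rescaling `u` makes the pairing with `v` take any prescribed value `a`.
  have := DFunLike.congr_fun h ((a / B u v) • u)
  simpa [pairingChar_apply, hu, Circle.coe_eq_one] using this

theorem pairingChar_injective (hτ : τ ≠ 1) (hB : ∀ v, (∀ u, B u v = 0) → v = 0) :
    Function.Injective (pairingChar τ B) := fun v w h =>
  sub_eq_zero.1 (pairingChar_eq_one hτ hB (by rw [pairingChar_sub, h, mul_inv_cancel]))

theorem pairingChar_bijective [Finite V] (hτ : τ ≠ 1) (hB : ∀ v, (∀ u, B u v = 0) → v = 0) :
    Function.Bijective (pairingChar τ B) := by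
  have := Fintype.ofFinite V
  exact (Fintype.bijective_iff_injective_and_card _).2
    ⟨pairingChar_injective hτ hB, AddChar.card_eq.symm⟩

theorem sum_pairingChar [Fintype V] [DecidableEq V] (hτ : τ ≠ 1)
    (hB : ∀ v, (∀ u, B u v = 0) → v = 0) (v : V) :
    ∑ u, (τ (B u v) : ℂ) = if v = 0 then (Fintype.card V : ℂ) else 0 := by
  split_ifs with h
  · simp [h]
  · exact AddChar.sum_eq_zero_of_ne_one (ψ := pairingChar τ B v)
      fun h' => h (pairingChar_eq_one hτ hB h')

theorem form_self (h2 : (2 : F) ≠ 0) (hskew : ∀ u v, B v u = -B u v) (u : V) :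
    B u u = 0 := by
  have h := hskew u u
  have h' : (2 : F) * B u u = 0 := by linear_combination h
  exact (mul_eq_zero.1 h').resolve_left h2

/-! ### Weyl operators and uniqueness of the Schrödinger representation -/

variable {H : Type w} [AddCommGroup H] [Module ℂ H]
variable {H' : Type w'} [AddCommGroup H'] [Module ℂ H']

theorem Heisenberg.mk_mul_mk (u v : V) (s t : Circle) :
    (⟨u, s⟩ * ⟨v, t⟩ : Heisenberg τ B) = ⟨u + v, s * t * τ (2⁻¹ * B u v)⟩ := rfl

theorem Heisenberg.one_eq : (1 : Heisenberg τ B) = ⟨0, 1⟩ := rfl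

/-- The operator `π (v, 1)`. -/
def weyl (π : Representation ℂ (Heisenberg τ B) H) (v : V) : Module.End ℂ H := π ⟨v, 1⟩

/-- `∑ π'(v) A π(v)⁻¹`. -/
def average [Fintype V] (π : Representation ℂ (Heisenberg τ B) H)
    (π' : Representation ℂ (Heisenberg τ B) H') (A : H →ₗ[ℂ] H') : H →ₗ[ℂ] H' :=
  ∑ v, weyl π' v ∘ₗ A ∘ₗ weyl π (-v)

theorem average_apply [Fintype V] (π : Representation ℂ (Heisenberg τ B) H)
    (π' : Representation ℂ (Heisenberg τ B) H') (A : H →ₗ[ℂ] H') (x : H) :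
    average π π' A x = ∑ v, weyl π' v (A (weyl π (-v) x)) := by
  simp [average]

section Weyl

variable {π : Representation ℂ (Heisenberg τ B) H}

theorem weyl_zero : weyl π 0 = 1 := by
  rw [weyl, ← Heisenberg.one_eq, map_one]

namespace IsSchrodinger

theorem apply_eq (hπ : IsSchrodinger π) (v : V) (s : Circle) (x : H) :
    π ⟨v, s⟩ x = (s : ℂ) • weyl π v x := by
  rw [← hπ.central, weyl, ← Module.End.mul_apply, ← map_mul, Heisenberg.mk_mul_mk]
  simp

theorem weyl_mul (hπ : IsSchrodinger π) (u v : V) :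
    weyl π u * weyl π v = (τ (2⁻¹ * B u v) : ℂ) • weyl π (u + v) := by
  ext x
  rw [LinearMap.smul_apply, ← hπ.apply_eq, weyl, weyl, ← map_mul, Heisenberg.mk_mul_mk]
  simp

theorem weyl_mul_apply (hπ : IsSchrodinger π) (u v : V) (x : H) :
    weyl π u (weyl π v x) = (τ (2⁻¹ * B u v) : ℂ) • weyl π (u + v) x :=
  LinearMap.congr_fun (hπ.weyl_mul u v) x

theorem weyl_neg_apply_weyl (hπ : IsSchrodinger π) (h2 : (2 : F) ≠ 0)
    (hskew : ∀ u v, B v u = -B u v) (u : V) (x : H) : weyl π (-u) (weyl π u x) = x := by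
  rw [hπ.weyl_mul_apply, neg_add_cancel, weyl_zero]
  simp [form_self h2 hskew]

theorem weyl_apply_weyl_neg (hπ : IsSchrodinger π) (h2 : (2 : F) ≠ 0)
    (hskew : ∀ u v, B v u = -B u v) (u : V) (x : H) : weyl π u (weyl π (-u) x) = x := by
  rw [hπ.weyl_mul_apply, add_neg_cancel, weyl_zero]
  simp [form_self h2 hskew]

theorem weyl_conj (hπ : IsSchrodinger π) (h2 : (2 : F) ≠ 0) (hskew : ∀ u v, B v u = -B u v)
    (u v : V) (x : H) :
    weyl π u (weyl π v (weyl π (-u) x)) = (τ (B u v) : ℂ) • weyl π v x := by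
  rw [hπ.weyl_mul_apply, hπ.weyl_mul_apply, smul_smul, ← Circle.coe_mul,
    ← AddChar.map_add_eq_mul, add_neg_cancel_comm]
  congr 4
  simp only [map_add, map_neg, LinearMap.add_apply, form_self h2 hskew, hskew u v]
  field_simp
  ring

/-- Linear independence of the Weyl operators: conjugation by `weyl π u` scales `weyl π v` by `τ(⟨u,
v⟩)`, so summing over `u` against `τ(⟨u, -w⟩)` isolates the term at `w`. -/
theorem coeff_eq_zero [Fintype V] [Nontrivial H] (hπ : IsSchrodinger π) (h2 : (2 : F) ≠ 0)
    (hskew : ∀ u v, B v u = -B u v) (hB : ∀ v, (∀ u, B u v = 0) → v = 0) (hτ : τ ≠ 1)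
    {a : V → ℂ} (h : ∀ x, ∑ v, a v • weyl π v x = 0) (w : V) : a w = 0 := by
  classical
  have key (x : H) : ∑ u, (τ (B u (-w)) : ℂ) •
      weyl π u (∑ v, a v • weyl π v (weyl π (-u) x)) = 0 := by simp [h]
  have key2 (x : H) : (Fintype.card V * a w) • weyl π w x = 0 := by
    rw [← key x]
    simp only [map_sum, map_smul, hπ.weyl_conj h2 hskew, Finset.smul_sum, smul_smul]
    rw [Finset.sum_comm]
    have e (v u : V) : (τ (B u (-w)) : ℂ) * (a v * (τ (B u v) : ℂ)) =
        (τ (B u (v - w)) : ℂ) * a v := by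
      rw [sub_eq_add_neg, map_add, AddChar.map_add_eq_mul, Circle.coe_mul]
      ring
    simp only [e, ← Finset.sum_smul, ← Finset.sum_mul, sum_pairingChar hτ hB, sub_eq_zero]
    simp
  obtain ⟨y, hy⟩ := exists_ne (0 : H)
  have h3 := key2 (weyl π (-w) y)
  rw [hπ.weyl_apply_weyl_neg h2 hskew, smul_eq_zero] at h3
  have : (Fintype.card V : ℂ) ≠ 0 := by exact_mod_cast Fintype.card_ne_zero
  simpa [hy, this] using h3

/-- A subspace stable under the operators `π (v, 1)` is trivial. -/
theorem eq_bot_or_eq_top (hπ : IsSchrodinger π) (p : Submodule ℂ H)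
    (hp : ∀ v, ∀ x ∈ p, weyl π v x ∈ p) : p = ⊥ ∨ p = ⊤ := by
  have := hπ.irreducible
  let q : Subrepresentation π := ⟨p, fun g x hx => by
    rw [show g = ⟨g.fst, g.snd⟩ from rfl, hπ.apply_eq]
    exact p.smul_mem _ (hp _ _ hx)⟩
  rcases IsSimpleOrder.eq_bot_or_eq_top q with h | h
  · exact Or.inl (congrArg Subrepresentation.toSubmodule h)
  · exact Or.inr (congrArg Subrepresentation.toSubmodule h)

theorem nontrivial (hπ : IsSchrodinger π) : Nontrivial H := by
  have := hπ.irreducible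
  by_contra hH
  rw [not_nontrivial_iff_subsingleton] at hH
  exact bot_ne_top (α := Subrepresentation π)
    (Subrepresentation.toSubmodule_injective (Subsingleton.elim _ _))

/-- The orbit of a nonzero vector under the finitely many Weyl operators spans a stable subspace,
hence everything. -/
theorem finiteDimensional [Finite V] (hπ : IsSchrodinger π) : FiniteDimensional ℂ H := by
  have := hπ.nontrivial
  obtain ⟨y, hy⟩ := exists_ne (0 : H)
  let p : Submodule ℂ H := Submodule.span ℂ (Set.range fun v => weyl π v y)
  have hp : ∀ v, ∀ x ∈ p, weyl π v x ∈ p := by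
    intro v x hx
    induction hx using Submodule.span_induction with
    | mem x hx =>
      obtain ⟨u, rfl⟩ := hx
      change weyl π v (weyl π u y) ∈ p
      rw [hπ.weyl_mul_apply]
      exact p.smul_mem _ (Submodule.subset_span ⟨_, rfl⟩)
    | zero => simp
    | add x z _ _ hx hz => rw [map_add]; exact p.add_mem hx hz
    | smul a x _ hx => rw [map_smul]; exact p.smul_mem _ hx
  have hyp : y ∈ p := Submodule.subset_span ⟨0, by simp [weyl_zero]⟩
  have hfin : FiniteDimensional ℂ p := FiniteDimensional.span_of_finite ℂ (Set.finite_range _)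
  rcases hπ.eq_bot_or_eq_top p hp with h | h
  · exact absurd ((Submodule.mem_bot ℂ).1 (h ▸ hyp)) hy
  · rw [h] at hfin
    exact Module.finite_def.2 (Module.Finite.iff_fg.1 hfin)

/-- Schur's lemma: an endomorphism that commutes with the representation is a scalar. -/
theorem exists_eq_smul [Finite V] (hπ : IsSchrodinger π) (f : Module.End ℂ H)
    (hf : ∀ v x, f (weyl π v x) = weyl π v (f x)) : ∃ c : ℂ, ∀ x, f x = c • x := by
  have := hπ.finiteDimensional
  have := hπ.nontrivial
  obtain ⟨c, hc⟩ := Module.End.exists_eigenvalue f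
  refine ⟨c, fun x => ?_⟩
  rcases hπ.eq_bot_or_eq_top (Module.End.eigenspace f c) (fun v x hx => by
    rw [Module.End.mem_eigenspace_iff] at hx ⊢
    rw [hf, hx, map_smul]) with h | h
  · exact absurd h hc
  · exact Module.End.mem_eigenspace_iff.1 (h ▸ Submodule.mem_top)

theorem bijective_of_ne_zero {π' : Representation ℂ (Heisenberg τ B) H'} (hπ : IsSchrodinger π)
    (hπ' : IsSchrodinger π') (f : H →ₗ[ℂ] H') (hf : ∀ v x, f (weyl π v x) = weyl π' v (f x))
    (h0 : f ≠ 0) : Function.Bijective f := by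
  constructor
  · refine LinearMap.ker_eq_bot.1 ((hπ.eq_bot_or_eq_top (LinearMap.ker f)
      fun v x hx => ?_).resolve_right fun h => h0 (LinearMap.ker_eq_top.1 h))
    rw [LinearMap.mem_ker] at hx ⊢
    rw [hf, hx, map_zero]
  · refine LinearMap.range_eq_top.1 ((hπ'.eq_bot_or_eq_top (LinearMap.range f) ?_).resolve_left
      fun h => h0 (LinearMap.range_eq_bot.1 h))
    rintro v _ ⟨x, rfl⟩
    exact ⟨weyl π v x, hf v x⟩

/-- Substituting `v ↦ u + v` in the sum works because both sides acquire the same phase `τ(2⁻¹ ⟨u,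
v⟩)`, by skew-symmetry. -/
theorem average_weyl [Fintype V] {π' : Representation ℂ (Heisenberg τ B) H'}
    (hπ : IsSchrodinger π) (hπ' : IsSchrodinger π') (h2 : (2 : F) ≠ 0)
    (hskew : ∀ u v, B v u = -B u v) (A : H →ₗ[ℂ] H') (u : V) (x : H) :
    average π π' A (weyl π u x) = weyl π' u (average π π' A x) := by
  rw [average_apply, average_apply, map_sum]
  refine (Fintype.sum_equiv (Equiv.addLeft u) _ _ fun v => ?_).symm
  rw [Equiv.coe_addLeft, hπ.weyl_mul_apply, hπ'.weyl_mul_apply, map_smul, map_smul,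
    show -(u + v) + u = -v by abel]
  congr 4
  simp [form_self h2 hskew, hskew u v]

/-- Two Schrödinger representations are equivalent. -/
theorem exists_equiv [Finite V] {π' : Representation ℂ (Heisenberg τ B) H'}
    (hπ : IsSchrodinger π) (hπ' : IsSchrodinger π') (h2 : (2 : F) ≠ 0)
    (hskew : ∀ u v, B v u = -B u v) (hB : ∀ v, (∀ u, B u v = 0) → v = 0) (hτ : τ ≠ 1) :
    ∃ f : H ≃ₗ[ℂ] H', ∀ g x, f (π g x) = π' g (f x) := by
  have := Fintype.ofFinite V
  have := hπ.nontrivial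
  have := hπ'.nontrivial
  obtain ⟨x, hx⟩ := exists_ne (0 : H)
  obtain ⟨φ, hφ⟩ : ∃ φ : Module.Dual ℂ H, φ x ≠ 0 := by
    by_contra! h
    exact hx ((Module.forall_dual_apply_eq_zero_iff ℂ x).1 h)
  -- If every such average vanished at `x`, independence of the operators `weyl π' v` would kill
  -- each coefficient `φ (weyl π (-v) x)`; the one at `v = 0` is `φ x ≠ 0`.
  obtain ⟨y, hy⟩ : ∃ y : H', average π π' (φ.smulRight y) ≠ 0 := by
    by_contra! h
    refine hφ ?_
    have := hπ'.coeff_eq_zero h2 hskew hB hτ (a := fun v => φ (weyl π (-v) x)) (fun y => by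
      have h' := LinearMap.congr_fun (h y) x
      rw [average_apply] at h'
      simpa using h') 0
    simpa [weyl_zero] using this
  refine ⟨LinearEquiv.ofBijective _ (hπ.bijective_of_ne_zero hπ' _
    (hπ.average_weyl hπ' h2 hskew _) hy), fun g x => ?_⟩
  rw [show g = ⟨g.fst, g.snd⟩ from rfl, hπ.apply_eq, hπ'.apply_eq, map_smul]
  exact congrArg _ (hπ.average_weyl hπ' h2 hskew _ _ _)

end IsSchrodinger
end Weyl

/-! ### Existence of a Schrödinger representation -/

theorem isSchrodinger_of_invariant [Nontrivial H] {π : Representation ℂ (Heisenberg τ B) H}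
    (hc : ∀ (s : Circle) (x : H), π ⟨0, s⟩ x = (s : ℂ) • x)
    (hp : ∀ p : Submodule ℂ H, (∀ g, ∀ x ∈ p, π g x ∈ p) → p = ⊥ ∨ p = ⊤) :
    IsSchrodinger π where
  central := hc
  irreducible :=
    { exists_pair_ne := ⟨⊥, ⊤, fun h =>
        bot_ne_top (α := Submodule ℂ H) (congrArg Subrepresentation.toSubmodule h)⟩
      eq_bot_or_eq_top := fun q =>
        (hp q.toSubmodule fun g _ hx => q.apply_mem_toSubmodule g hx).imp
          (fun h => Subrepresentation.toSubmodule_injective h)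
          (fun h => Subrepresentation.toSubmodule_injective h) }

/-- The twisted regular representation `(π (u, s) f) (x) = s τ(2⁻¹ ⟨x, u⟩) f (x + u)` on functions
on `V`, with `V` indexed by `X`. -/
def functionRep (τ : AddChar F Circle) (B : LinearMap.BilinForm F V) {X : Type w} (e : X ≃ V) :
    Representation ℂ (Heisenberg τ B) (X → ℂ) where
  toFun g :=
    { toFun f x := g.snd * (τ (2⁻¹ * B (e x) g.fst) : ℂ) * f (e.symm (e x + g.fst))
      map_add' f f' := by ext x; simp [mul_add]
      map_smul' a f := by ext x; simp; ring }
  map_one' := by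
    ext1 f
    ext x
    simp [Heisenberg.one_eq]
  map_mul' g h := by
    ext1 f
    ext x
    obtain ⟨u, s⟩ := g
    obtain ⟨v, t⟩ := h
    rw [Heisenberg.mk_mul_mk]
    simp only [LinearMap.coe_mk, AddHom.coe_mk, Module.End.mul_apply, Equiv.apply_symm_apply,
      map_add, LinearMap.add_apply, mul_add, AddChar.map_add_eq_mul, Circle.coe_mul, add_assoc]
    ring

theorem functionRep_apply {X : Type w} (e : X ≃ V) (u : V) (s : Circle) (f : X → ℂ) (x : X) :
    functionRep τ B e ⟨u, s⟩ f x =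
      s * (τ (2⁻¹ * B (e x) u) : ℂ) * f (e.symm (e x + u)) := rfl

/-- A minimal nonzero stable subspace of the twisted regular representation is irreducible. Indexing
`V` by `Fin n` places the space in `Type`, whatever the universe of `V`. -/
theorem exists_isSchrodinger [Finite V] (τ : AddChar F Circle) (B : LinearMap.BilinForm F V) :
    ∃ (H : Type) (_ : AddCommGroup H) (_ : Module ℂ H)
      (π : Representation ℂ (Heisenberg τ B) H), IsSchrodinger π := by
  obtain ⟨n, ⟨e⟩⟩ := Finite.exists_equiv_fin V
  let ρ := functionRep τ B e.symm
  have : Nonempty (Fin n) := ⟨e 0⟩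
  let S : Set (Submodule ℂ (Fin n → ℂ)) := {p | p ≠ ⊥ ∧ ∀ g, ∀ x ∈ p, ρ g x ∈ p}
  obtain ⟨p, ⟨hp0, hp⟩, hmin⟩ := exists_minimal_of_wellFoundedLT (· ∈ S)
    ⟨⊤, top_ne_bot, fun _ _ _ => Submodule.mem_top⟩
  let q : Subrepresentation ρ := ⟨p, fun g x hx => hp g x hx⟩
  have : Nontrivial p := (Submodule.nontrivial_iff_ne_bot).2 hp0
  refine ⟨p, inferInstance, inferInstance, q.toRepresentation,
    isSchrodinger_of_invariant (fun s x => ?_) fun r hr => ?_⟩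
  · ext i
    change functionRep τ B e.symm ⟨0, s⟩ x.1 i = s * x.1 i
    rw [functionRep_apply]
    simp
  · by_cases hr0 : r = ⊥
    · exact Or.inl hr0
    · refine Or.inr ?_
      have hle : r.map p.subtype ≤ p := Submodule.map_subtype_le p r
      have hS : r.map p.subtype ∈ S := by
        refine ⟨fun h => hr0 (Submodule.map_injective_of_injective
          p.injective_subtype (h.trans (Submodule.map_bot _).symm)), ?_⟩
        rintro g _ ⟨x, hx, rfl⟩
        exact ⟨_, hr g x hx, rfl⟩
      have := hmin hS hle
      refine eq_top_iff.2 fun x _ => ?_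
      obtain ⟨y, hy, hyx⟩ := this x.2
      rwa [← Subtype.ext hyx]

/-! ### The Weil family and its factor set -/

/-- The automorphism `(u, s) ↦ (uσ, s)` of the Heisenberg group. -/
def heisenbergHom (τ : AddChar F Circle) (σ : Sp B) : Heisenberg τ B →* Heisenberg τ B where
  toFun g := ⟨σ.1 g.fst, g.snd⟩
  map_one' := by simp [Heisenberg.one_eq]
  map_mul' g h := by
    obtain ⟨u, s⟩ := g
    obtain ⟨v, t⟩ := h
    simp [Heisenberg.mk_mul_mk, σ.2 u v]

variable {π : Representation ℂ (Heisenberg τ B) H}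

namespace IsSchrodinger

theorem comp_heisenbergHom (hπ : IsSchrodinger π) (σ : Sp B) :
    IsSchrodinger (π.comp (heisenbergHom τ σ) : Representation ℂ (Heisenberg τ B) H) := by
  have := hπ.nontrivial
  refine isSchrodinger_of_invariant (fun s x => ?_) fun p hp =>
    hπ.eq_bot_or_eq_top p fun v x hx => ?_
  · rw [← hπ.central]
    simp [heisenbergHom]
  · have := hp ⟨σ.1.symm v, 1⟩ x hx
    simpa [heisenbergHom, weyl] using this

theorem exists_isWeilFamily [Finite V] (hπ : IsSchrodinger π) (h2 : (2 : F) ≠ 0)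
    (hskew : ∀ u v, B v u = -B u v) (hB : ∀ v, (∀ u, B u v = 0) → v = 0) (hτ : τ ≠ 1) :
    ∃ T : Sp B → (H ≃ₗ[ℂ] H), IsWeilFamily π T := by
  -- `T σ` is an equivalence from the twist of `π` by `σ` to `π` itself.
  choose T hT using fun σ : Sp B =>
    (hπ.comp_heisenbergHom σ).exists_equiv hπ h2 hskew hB hτ
  refine ⟨T, fun σ u s x => ?_⟩
  exact ((T σ).symm_apply_eq.2 (hT σ ⟨u, s⟩ x).symm).symm

end IsSchrodinger

theorem IsWeilFamily.apply_weyl {T : Sp B → (H ≃ₗ[ℂ] H)} (hT : IsWeilFamily π T) (σ : Sp B) (u : V)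
    (x : H) : T σ (weyl π (σ.1 u) x) = weyl π u (T σ x) := by
  rw [weyl, hT, LinearEquiv.apply_symm_apply]
  rfl

theorem IsWeilFamily.existsUnique_isFactorSet [Finite V] {T : Sp B → (H ≃ₗ[ℂ] H)}
    (hT : IsWeilFamily π T) (hπ : IsSchrodinger π) :
    ∃! c : Sp B → Sp B → ℂˣ, IsFactorSet T c := by
  have := hπ.nontrivial
  obtain ⟨y, hy⟩ := exists_ne (0 : H)
  have key (σ σ' : Sp B) : ∃ c : ℂˣ, ∀ x, T σ (T σ' x) = (c : ℂ) • T (σ' * σ) x := by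
    -- `T(σ'σ)⁻¹ T(σ) T(σ')` commutes with all Weyl operators, so it is a scalar by Schur's lemma.
    let f : H ≃ₗ[ℂ] H := (T σ' ≪≫ₗ T σ) ≪≫ₗ (T (σ' * σ)).symm
    have hfT (x : H) : T σ (T σ' x) = T (σ' * σ) (f x) := by simp [f]
    obtain ⟨c, hc⟩ := hπ.exists_eq_smul f.toLinearMap fun v x => by
      apply (T (σ' * σ)).injective
      obtain ⟨u, rfl⟩ := (σ' * σ).1.surjective v
      rw [hT.apply_weyl]
      change T (σ' * σ) (f _) = weyl π u (T (σ' * σ) (f x))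
      rw [← hfT, ← hfT]
      change T σ (T σ' (weyl π (σ'.1 (σ.1 u)) x)) = _
      rw [hT.apply_weyl, hT.apply_weyl]
    have hc0 : c ≠ 0 := by
      rintro rfl
      have : f y = 0 := by simpa using hc y
      exact hy (f.map_eq_zero_iff.1 this)
    refine ⟨Units.mk0 c hc0, fun x => ?_⟩
    rw [hfT, show f x = c • x from hc x, map_smul, Units.val_mk0]
  choose c hc using key
  refine ⟨c, hc, fun c' hc' => ?_⟩
  ext σ σ'
  have h := (hc' σ σ' y).symm.trans (hc σ σ' y)
  exact smul_left_injective ℂ ((T (σ' * σ)).map_ne_zero_iff.2 hy) h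

/-- Take determinants on `p` in the defining relation of `c`; the scalar contributes its power of
exponent `dim p`. -/
theorem IsFactorSet.exists_det {T : Sp B → (H ≃ₗ[ℂ] H)} {c : Sp B → Sp B → ℂˣ}
    [FiniteDimensional ℂ H] (hc : IsFactorSet T c) (p : Submodule ℂ H)
    (hp : ∀ σ, ∀ x ∈ p, T σ x ∈ p) :
    ∃ a : Sp B → ℂˣ, ∀ σ σ', a σ * a σ' = c σ σ' ^ Module.finrank ℂ p * a (σ' * σ) := by
  let t (σ : Sp B) : Module.End ℂ p := (T σ).toLinearMap.restrict (hp σ)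
  have ht (σ : Sp B) : LinearMap.det (t σ) ≠ 0 := by
    rw [Ne, LinearMap.det_eq_zero_iff_ker_ne_bot, not_not, LinearMap.ker_eq_bot]
    intro x y h
    exact Subtype.ext ((T σ).injective (congrArg Subtype.val h))
  refine ⟨fun σ => Units.mk0 _ (ht σ), fun σ σ' => ?_⟩
  ext
  simp only [Units.val_mul, Units.val_mk0, Units.val_pow_eq_pow_val]
  rw [← map_mul, ← LinearMap.det_smul]
  congr 1
  ext x
  exact hc σ σ' x

/-! ### Dimension, parity operator and triviality of the factor set -/

namespace IsSchrodinger

/-- For a suitable `u`, `weyl π v` is conjugate to its multiple by `τ(⟨u, v⟩) ≠ 1`. -/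
theorem trace_weyl [Finite V] (hπ : IsSchrodinger π) (h2 : (2 : F) ≠ 0)
    (hskew : ∀ u v, B v u = -B u v) (hB : ∀ v, (∀ u, B u v = 0) → v = 0) (hτ : τ ≠ 1)
    {v : V} (hv : v ≠ 0) : LinearMap.trace ℂ H (weyl π v) = 0 := by
  have := hπ.finiteDimensional
  obtain ⟨u, hu⟩ := DFunLike.ne_iff.1 fun h => hv (pairingChar_eq_one hτ hB h)
  have h1 : weyl π u * weyl π v * weyl π (-u) = (τ (B u v) : ℂ) • weyl π v :=
    LinearMap.ext fun x => hπ.weyl_conj h2 hskew u v x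
  have h3 : weyl π (-u) * weyl π u = 1 :=
    LinearMap.ext fun x => hπ.weyl_neg_apply_weyl h2 hskew u x
  have h4 := congrArg (LinearMap.trace ℂ H) h1
  rw [LinearMap.trace_mul_comm, ← mul_assoc, h3, one_mul, map_smul, smul_eq_mul] at h4
  rw [pairingChar_apply, AddChar.one_apply] at hu
  by_contra h
  exact hu (mul_right_cancel₀ h (by rw [← h4, one_mul]))

/-- The averages of the rank-one maps `A i` are scalars `l i`, which traces determine. Evaluating `∑
i, average π π (A i) (b i)` through these scalars, and again through the vanishing traces of Weyl
operators, gives `d² y = |V| y`. -/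
theorem sq_finrank [Fintype V] (hπ : IsSchrodinger π) (h2 : (2 : F) ≠ 0)
    (hskew : ∀ u v, B v u = -B u v) (hB : ∀ v, (∀ u, B u v = 0) → v = 0) (hτ : τ ≠ 1) :
    (Module.finrank ℂ H : ℂ) ^ 2 = Fintype.card V := by
  classical
  have := hπ.finiteDimensional
  have := hπ.nontrivial
  obtain ⟨y, hy⟩ := exists_ne (0 : H)
  let b := Module.finBasis ℂ H
  let A (i : Fin (Module.finrank ℂ H)) : Module.End ℂ H := (b.coord i).smulRight y
  choose l hl using fun i => hπ.exists_eq_smul (average π π (A i))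
    (hπ.average_weyl hπ h2 hskew _)
  have htr (i) : l i * Module.finrank ℂ H = Fintype.card V * b.coord i y := by
    have e : average π π (A i) = l i • 1 := LinearMap.ext (hl i)
    have h := congrArg (LinearMap.trace ℂ H) e
    rw [map_smul, LinearMap.trace_one, smul_eq_mul, average, map_sum] at h
    rw [← h, Finset.sum_congr rfl (g := fun _ => b.coord i y)]
    · simp
    · intro v _
      have h3 : weyl π (-v) * weyl π v = 1 :=
        LinearMap.ext fun x => hπ.weyl_neg_apply_weyl h2 hskew v x
      change LinearMap.trace ℂ H (weyl π v * (A i * weyl π (-v))) = _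
      rw [LinearMap.trace_mul_comm, mul_assoc, h3, mul_one, LinearMap.trace_smulRight]
  have hsum : ∑ i, average π π (A i) (b i) = (Module.finrank ℂ H : ℂ) • y := by
    simp only [average_apply]
    rw [Finset.sum_comm]
    have e (v : V) : ∑ i, weyl π v (A i (weyl π (-v) (b i))) =
        LinearMap.trace ℂ H (weyl π (-v)) • weyl π v y := by
      rw [LinearMap.trace_eq_matrix_trace ℂ b, Matrix.trace, Finset.sum_smul]
      refine Finset.sum_congr rfl fun i _ => ?_
      simp [A, LinearMap.toMatrix_apply]
    simp only [e]
    rw [Finset.sum_eq_single 0 (fun v _ hv => by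
      rw [hπ.trace_weyl h2 hskew hB hτ (neg_ne_zero.2 hv), zero_smul]) (by simp)]
    simp [weyl_zero]
  have h : (Module.finrank ℂ H : ℂ) ^ 2 • y = (Fintype.card V : ℂ) • y := by
    rw [pow_two, mul_smul, ← hsum]
    conv_rhs => rw [← b.sum_repr y]
    rw [Finset.smul_sum, Finset.smul_sum]
    refine Finset.sum_congr rfl fun i _ => ?_
    rw [hl, smul_smul, smul_smul, mul_comm, htr]
    rfl
  exact smul_left_injective ℂ hy h

/-- The parity operator, a multiple of `∑ π(v, 1)`, commutes with the Weil family; its eigenspaces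
for `1` and `-1` have dimensions that differ by one. -/
theorem exists_invariant_pair [Finite V] (hπ : IsSchrodinger π) (h2 : (2 : F) ≠ 0)
    (hskew : ∀ u v, B v u = -B u v) (hB : ∀ v, (∀ u, B u v = 0) → v = 0) (hτ : τ ≠ 1)
    {T : Sp B → (H ≃ₗ[ℂ] H)} (hT : IsWeilFamily π T) :
    ∃ p q : Submodule ℂ H, (∀ σ, ∀ x ∈ p, T σ x ∈ p) ∧ (∀ σ, ∀ x ∈ q, T σ x ∈ q) ∧
      Module.finrank ℂ p = Module.finrank ℂ q + 1 := by
  classical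
  have := Fintype.ofFinite V
  have := hπ.finiteDimensional
  have := hπ.nontrivial
  let d : ℂ := Module.finrank ℂ H
  have hd : d ≠ 0 := Nat.cast_ne_zero.2 Module.finrank_pos.ne'
  let S : Module.End ℂ H := ∑ v, weyl π v
  -- After `v ↦ u + v` the phase is `τ(⟨u, v/2⟩)`; summing over `u` leaves only `v = 0`, with weight
  -- `|V| = d²`.
  have hSS : S * S = d ^ 2 • 1 := by
    have e (u : V) : ∑ v, weyl π u * weyl π v =
        ∑ v, (τ (B u ((2 : F)⁻¹ • v)) : ℂ) • weyl π v := by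
      refine Fintype.sum_equiv (Equiv.addLeft u) _ _ fun v => ?_
      rw [hπ.weyl_mul, Equiv.coe_addLeft]
      simp [form_self h2 hskew]
    simp only [S]
    rw [Finset.sum_mul_sum]
    simp only [e]
    rw [Finset.sum_comm]
    simp only [← Finset.sum_smul, sum_pairingChar hτ hB]
    rw [Finset.sum_eq_single 0 (fun v _ hv => by simp [hv, h2]) (by simp)]
    simp [weyl_zero, d, hπ.sq_finrank h2 hskew hB hτ]
  have htrS : LinearMap.trace ℂ H S = d := by
    simp only [S]
    rw [map_sum, Finset.sum_eq_single 0
      (fun v _ hv => hπ.trace_weyl h2 hskew hB hτ hv) (by simp), weyl_zero, LinearMap.trace_one]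
  have hTS (σ : Sp B) (x : H) : T σ (S x) = S (T σ x) := by
    simp only [S, LinearMap.sum_apply, map_sum]
    refine (Fintype.sum_equiv σ.1.toEquiv _ _ fun v => ?_).symm
    exact (hT.apply_weyl σ v x).symm
  let R : Module.End ℂ H := d⁻¹ • S
  have hRR : R * R = 1 := by
    simp only [R]
    rw [smul_mul_smul_comm, hSS, smul_smul]
    field_simp
    simp
  have htrR : LinearMap.trace ℂ H R = 1 := by
    simp only [R]
    rw [map_smul, htrS, smul_eq_mul, inv_mul_cancel₀ hd]
  have hTR (σ : Sp B) (x : H) : T σ (R x) = R (T σ x) := by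
    simp only [R, LinearMap.smul_apply, map_smul, hTS]
  -- For `e = ±1` this projects onto the `e`-eigenspace of `R`, and its rank is its trace `(d + e) /
  -- 2`.
  let P (e : ℂ) : Module.End ℂ H := (2⁻¹ : ℂ) • (1 + e • R)
  have hP {e : ℂ} (he : e * e = 1) : IsIdempotentElem (P e) := by
    simp only [P, IsIdempotentElem]
    rw [smul_mul_smul_comm, mul_add, add_mul, add_mul, smul_mul_smul_comm, hRR, he]
    simp only [mul_one, one_mul]
    module
  have hstab (e : ℂ) (σ : Sp B) : ∀ x ∈ LinearMap.range (P e), T σ x ∈ LinearMap.range (P e) := by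
    rintro _ ⟨x, rfl⟩
    exact ⟨T σ x, by simp [P, hTR]⟩
  have hrank {e : ℂ} (he : e * e = 1) :
      (Module.finrank ℂ (LinearMap.range (P e)) : ℂ) = 2⁻¹ * (d + e) := by
    rw [← (LinearMap.IsIdempotentElem.isProj_range _ (hP he)).trace]
    simp only [P, map_smul, map_add, htrR, LinearMap.trace_one, smul_eq_mul, mul_one, d]
  refine ⟨_, _, hstab 1, hstab (-1), ?_⟩
  have h1 := hrank (e := 1) (by norm_num)
  have h3 := hrank (e := -1) (by norm_num)
  have : (Module.finrank ℂ (LinearMap.range (P 1)) : ℂ) =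
      Module.finrank ℂ (LinearMap.range (P (-1))) + 1 := by
    rw [h1, h3]; ring
  exact_mod_cast this

/-- The factor set of the Weil representation is a coboundary. -/
theorem exists_coboundary [Finite V] (hπ : IsSchrodinger π) (h2 : (2 : F) ≠ 0)
    (hskew : ∀ u v, B v u = -B u v) (hB : ∀ v, (∀ u, B u v = 0) → v = 0) (hτ : τ ≠ 1)
    {T : Sp B → (H ≃ₗ[ℂ] H)} (hT : IsWeilFamily π T) {c : Sp B → Sp B → ℂˣ}
    (hc : IsFactorSet T c) :
    ∃ a : Sp B → ℂˣ, ∀ σ σ', a σ * a σ' = c σ σ' * a (σ' * σ) := by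
  have := hπ.finiteDimensional
  obtain ⟨p, q, hp, hq, hpq⟩ := hπ.exists_invariant_pair h2 hskew hB hτ hT
  obtain ⟨a, ha⟩ := hc.exists_det p hp
  obtain ⟨b, hb⟩ := hc.exists_det q hq
  -- The exponents of `c` for `p` and `q` differ by one, so the quotient leaves `c` itself.
  refine ⟨fun σ => a σ / b σ, fun σ σ' => ?_⟩
  rw [div_mul_div_comm, ha, hb, hpq, pow_succ', mul_assoc, mul_div_assoc, mul_div_mul_left_eq_div]

end IsSchrodinger
end Heisenberg

/-! ### Regular matrices, nondegeneracy and the order of `F[β]ˣ` -/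

section Matrices

open Polynomial

variable {F : Type u} [Field F] {n : ℕ} {β : Matrix (Fin n) (Fin n) F}

theorem form_skew (u v : VBeta β) : form β v u = -form β u v := by
  obtain ⟨X, rfl⟩ := Submodule.mkQ_surjective _ u
  obtain ⟨Y, rfl⟩ := Submodule.mkQ_surjective _ v
  exact matrixForm_neg β X Y

theorem mem_alg_iff {X : Matrix (Fin n) (Fin n) F} : X ∈ Alg β ↔ ∃ q : F[X], aeval β q = X := by
  rw [Alg, Algebra.adjoin_singleton_eq_range_aeval F β]
  rfl

/-- A regular matrix has a cyclic vector. -/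
theorem exists_cyclic_vector (hreg : minpoly F β = β.charpoly) :
    ∃ x : Fin n → F, ∀ y, ∃ q : F[X], (aeval β q).mulVec x = y := by
  let φ : Module.End F (Fin n → F) := Matrix.toLin' β
  have hφ (q : F[X]) (y : Fin n → F) : aeval φ q y = (aeval β q).mulVec y := by
    have : aeval φ q = Matrix.toLin' (aeval β q) :=
      (aeval_algHom_apply (Matrix.toLinAlgEquiv' (R := F) (n := Fin n)).toAlgHom β q)
    rw [this, Matrix.toLin'_apply]
  -- Some vector has the same annihilator in `F[X]` as the whole module, namely the ideal of
  -- `minpoly F β`. As this has degree `n`, polynomials of degree below `n` act injectively on the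
  -- vector, and counting dimensions gives cyclicity.
  obtain ⟨x, hx⟩ := Module.exists_ker_toSpanSingleton_eq_annihilator F[X] (Module.AEval' φ)
  obtain ⟨x, rfl⟩ := (Module.AEval'.of φ).surjective x
  have hx' (q : F[X]) (hq : (aeval β q).mulVec x = 0) : aeval β q = 0 := by
    have h : q ∈ LinearMap.ker (LinearMap.toSpanSingleton F[X] _ (Module.AEval'.of φ x)) := by
      rw [LinearMap.mem_ker, LinearMap.toSpanSingleton_apply, ← Module.AEval.of_aeval_smul,
        Module.End.smul_def, hφ, hq, map_zero]
    rw [hx, Module.AEval.annihilator_eq_ker_aeval, RingHom.mem_ker] at h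
    refine Matrix.toLin'.injective (LinearMap.ext fun y => ?_)
    rw [Matrix.toLin'_apply, ← hφ, h]
    simp
  let f : degreeLT F n →ₗ[F] (Fin n → F) :=
    { toFun q := (aeval β (q : F[X])).mulVec x
      map_add' p q := by simp [Matrix.add_mulVec]
      map_smul' a q := by simp [Matrix.smul_mulVec] }
  have hf : Function.Injective f := by
    rw [← LinearMap.ker_eq_bot, LinearMap.ker_eq_bot']
    intro q hq
    have h0 := minpoly.dvd F β (hx' q hq)
    have hdeg := mem_degreeLT.1 q.2
    refine Subtype.ext (eq_zero_of_dvd_of_degree_lt h0 ?_)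
    rwa [hreg, Matrix.charpoly_degree_eq_dim, Fintype.card_fin]
  have hdim : Module.finrank F (degreeLT F n) = Module.finrank F (Fin n → F) :=
    (degreeLTEquiv F n).finrank_eq
  have : FiniteDimensional F (degreeLT F n) := (degreeLTEquiv F n).symm.finiteDimensional
  refine ⟨x, fun y => ?_⟩
  obtain ⟨q, hq⟩ := (LinearMap.injective_iff_surjective_of_finrank_eq_finrank hdim).1 hf y
  exact ⟨q, hq⟩

/-- A matrix commuting with `β` is determined by its value on a cyclic vector `x`, and `X x = p(β)
x` for some `p`. -/
theorem mem_alg_of_commute (hreg : minpoly F β = β.charpoly) {X : Matrix (Fin n) (Fin n) F}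
    (hX : X * β = β * X) : X ∈ Alg β := by
  obtain ⟨x, hx⟩ := exists_cyclic_vector hreg
  obtain ⟨p, hp⟩ := hx (X.mulVec x)
  have hc (q : F[X]) : X * aeval β q = aeval β q * X := by
    induction q using Polynomial.induction_on' with
    | add p q hp hq => simp [mul_add, add_mul, hp, hq]
    | monomial k a =>
      rw [aeval_monomial, ← mul_assoc, ← Algebra.commutes, mul_assoc, mul_assoc,
        ((show Commute X β from hX).pow_right k).eq]
  have : X = aeval β p := by
    refine Matrix.toLin'.injective (LinearMap.ext fun y => ?_)
    obtain ⟨q, rfl⟩ := hx y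
    rw [Matrix.toLin'_apply, Matrix.toLin'_apply, Matrix.mulVec_mulVec, Matrix.mulVec_mulVec, hc,
      ← map_mul, mul_comm, map_mul, ← Matrix.mulVec_mulVec, ← Matrix.mulVec_mulVec, hp]
  exact mem_alg_iff.2 ⟨p, this.symm⟩

/-- Since `⟨X, Y⟩ = tr(X (Yβ - βY))` and the trace pairing is nondegenerate, the radical is the
centraliser of `β` modulo `F[β]`. -/
theorem form_nondegenerate (hreg : minpoly F β = β.charpoly) (v : VBeta β)
    (hv : ∀ u, form β u v = 0) : v = 0 := by
  obtain ⟨Y, rfl⟩ := Submodule.mkQ_surjective _ v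
  refine (Submodule.Quotient.mk_eq_zero _).2 (mem_alg_of_commute hreg ?_)
  refine Matrix.ext_iff_trace_mul_left.2 fun X => ?_
  have h := hv (toV β X)
  change ((X * Y - Y * X) * β).trace = 0 at h
  rw [sub_mul, Matrix.trace_sub, sub_eq_zero] at h
  rw [← mul_assoc, h, mul_assoc, Matrix.trace_mul_comm, mul_assoc]

theorem isReduced_alg (hreg : minpoly F β = β.charpoly) (hsep : β.charpoly.Separable) :
    IsReduced (Alg β) := by
  refine ⟨fun x ⟨k, hk⟩ => ?_⟩
  obtain ⟨x, hx⟩ := x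
  have hk : x ^ k = 0 := congrArg Subtype.val hk
  refine Subtype.ext ?_
  change x = 0
  obtain ⟨q, rfl⟩ := mem_alg_iff.1 hx
  change (aeval β q) ^ k = 0 at hk
  rw [← map_pow] at hk
  rw [← hreg] at hsep
  obtain ⟨r, hr⟩ := hsep.squarefree.isRadical k q (minpoly.dvd F β hk)
  rw [hr, map_mul, minpoly.aeval, zero_mul]

/-- By Cauchy there would be a unit `ε` of order `p`; then `(ε - 1)^p = ε^p - 1 = 0`, and
reducedness forces `ε = 1`. -/
theorem card_units_ne_zero [Finite F] (hreg : minpoly F β = β.charpoly)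
    (hsep : β.charpoly.Separable) [Fintype (Alg β)ˣ] : (Fintype.card (Alg β)ˣ : F) ≠ 0 := by
  intro h
  have := isReduced_alg hreg hsep
  obtain ⟨p, hp⟩ := CharP.exists F
  have hpp : p.Prime := (CharP.char_is_prime_or_zero F p).resolve_right
    (CharP.char_ne_zero_of_finite F p)
  have : Fact p.Prime := ⟨hpp⟩
  obtain ⟨ε, hε⟩ := exists_prime_orderOf_dvd_card p ((CharP.cast_eq_zero_iff F p _).1 h)
  -- For `n = 0` the algebra is zero and does not have characteristic `p`.
  by_cases hn : Subsingleton (Alg β)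
  · have : ε = 1 := Subsingleton.elim _ _
    rw [this, orderOf_one] at hε
    exact hpp.one_lt.ne hε
  have : Nontrivial (Alg β) := not_subsingleton_iff_nontrivial.1 hn
  have : CharP (Alg β) p := charP_of_injective_algebraMap (algebraMap F (Alg β)).injective p
  have hcomm : Commute (ε : Alg β) 1 := Commute.one_right _
  have h1 : ((ε : Alg β) - 1) ^ p = 0 := by
    have hε' : ε ^ p = 1 := hε ▸ pow_orderOf_eq_one ε
    rw [sub_pow_char_of_commute p hcomm, one_pow, ← Units.val_pow_eq_pow_val, hε', Units.val_one,
      sub_self]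
  have h3 : (ε : Alg β) = 1 := sub_eq_zero.1 (eq_zero_of_pow_eq_zero h1)
  have h4 : ε = 1 := Units.ext h3
  rw [h4, orderOf_one] at hε
  exact hpp.one_lt.ne hε

/-! ### The displacements `v_ε` and the cocycle `c_{β,ρ}` -/

theorem sigma_mul (ε η : (Alg β)ˣ) : sigma (ε * η) = sigma η * sigma ε := by
  refine Subtype.ext (LinearEquiv.ext fun v => ?_)
  obtain ⟨X, rfl⟩ := Submodule.mkQ_surjective _ v
  change toV β (conj (ε * η) X) = toV β (conj η (conj ε X))
  simp [conj_apply, mul_assoc]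

/-- Conjugation by `η` fixes `γ(v, ε)`, because `F[β]` is commutative. -/
theorem gamma_mul (s : VBeta β →ₗ[F] Matrix (Fin n) (Fin n) F) (hs : IsSplitting s) (v : VBeta β)
    (ε η : (Alg β)ˣ) :
    gamma s hs v (ε * η) = gamma s hs v ε + gamma s hs ((sigma ε).1 v) η := by
  refine Subtype.ext ?_
  have h1 := conj_of_mem η (gamma s hs v ε).2
  change conj η (conj ε (s v) - s ((sigma ε).1 v)) = _ at h1
  change conj (ε * η) (s v) - s ((sigma (ε * η)).1 v) = (gamma s hs v ε : Matrix _ _ F) +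
    (conj η (s ((sigma ε).1 v)) - s ((sigma η).1 ((sigma ε).1 v)))
  rw [← h1, map_sub, sigma_mul]
  have h2 : conj (ε * η) (s v) = conj η (conj ε (s v)) := by simp [conj_apply, mul_assoc]
  rw [h2]
  change _ - s ((sigma η).1 ((sigma ε).1 v)) = _
  abel

/-- The character `v ↦ ρ(γ(v, ε))`. -/
def gammaChar (ρ : AddChar (Alg β) ℂ) (s : VBeta β →ₗ[F] Matrix (Fin n) (Fin n) F)
    (hs : IsSplitting s) (ε : (Alg β)ˣ) : AddChar (VBeta β) ℂ where
  toFun v := ρ (gamma s hs v ε)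
  map_zero_eq_one' := by
    rw [show gamma s hs 0 ε = 0 from Subtype.ext (by simp [gamma]), AddChar.map_zero_eq_one]
  map_add_eq_mul' u v := by
    rw [← AddChar.map_add_eq_mul]
    congr 1
    refine Subtype.ext ?_
    simp only [gamma, map_add, mul_add, add_mul, Subalgebra.coe_add]
    abel

variable {τ : AddChar F Circle} {ρ : AddChar (Alg β) ℂ}

theorem existsUnique_isDisplacement [Finite F] (hτ : τ ≠ 1) (hreg : minpoly F β = β.charpoly)
    (s : VBeta β →ₗ[F] Matrix (Fin n) (Fin n) F) (hs : IsSplitting s) :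
    ∃! d : (Alg β)ˣ → VBeta β, IsDisplacement τ ρ s hs d := by
  have : Finite (VBeta β) := Quotient.finite _
  obtain ⟨hinj, hsurj⟩ := pairingChar_bijective hτ (form_nondegenerate hreg)
  choose d hd using fun ε => hsurj (gammaChar ρ s hs ε)
  refine ⟨d, fun ε v => (DFunLike.congr_fun (hd ε) v).symm, fun d' hd' => ?_⟩
  ext1 ε
  exact hinj (DFunLike.ext _ _ fun v => (hd' ε v).symm.trans (DFunLike.congr_fun (hd ε) v).symm)

namespace IsDisplacement

variable {s : VBeta β →ₗ[F] Matrix (Fin n) (Fin n) F} {hs : IsSplitting s} {d : (Alg β)ˣ → VBeta β}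

/-- The 1-cocycle relation for `d`, dual to `gamma_mul` under the invariant pairing. -/
theorem map_mul (hd : IsDisplacement τ ρ s hs d) (hτ : τ ≠ 1) (hreg : minpoly F β = β.charpoly)
    (ε η : (Alg β)ˣ) : d (ε * η) = d ε + (sigma ε).1.symm (d η) := by
  refine pairingChar_injective hτ (form_nondegenerate hreg) (DFunLike.ext _ _ fun v => ?_)
  have h : form β ((sigma ε).1 v) (d η) = form β v ((sigma ε).1.symm (d η)) := by
    rw [← (sigma ε).2 v, LinearEquiv.apply_symm_apply]
  rw [pairingChar_apply, pairingChar_apply, map_add, AddChar.map_add_eq_mul, Circle.coe_mul, ← h,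
    ← hd, ← hd, ← hd, gamma_mul, AddChar.map_add_eq_mul]

theorem exists_eq_sub [Finite F] (hd : IsDisplacement τ ρ s hs d) (hτ : τ ≠ 1)
    (hreg : minpoly F β = β.charpoly) (hsep : β.charpoly.Separable) :
    ∃ w, ∀ ε, d ε = w - (sigma ε).1.symm w := by
  have := Fintype.ofFinite (Alg β)ˣ
  have hN := card_units_ne_zero hreg hsep
  -- The mean of `d`: summing the 1-cocycle relation over `η` yields the claim.
  refine ⟨(Fintype.card (Alg β)ˣ : F)⁻¹ • ∑ η, d η, fun ε => ?_⟩
  have h : ∑ η, d η = (Fintype.card (Alg β)ˣ : F) • d ε + (sigma ε).1.symm (∑ η, d η) := by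
    conv_lhs => rw [← Equiv.sum_comp (Equiv.mulLeft ε)]
    simp only [Equiv.coe_mulLeft, hd.map_mul hτ hreg, Finset.sum_add_distrib, map_sum]
    simp [Nat.cast_smul_eq_nsmul]
  rw [map_smul, ← smul_sub, eq_inv_smul_iff₀ hN]
  exact eq_sub_of_add_eq h.symm

/-- The cocycle `c_{β,ρ}` is a coboundary. -/
theorem exists_coboundary [Finite F] (hd : IsDisplacement τ ρ s hs d) (h2 : (2 : F) ≠ 0)
    (hτ : τ ≠ 1) (hreg : minpoly F β = β.charpoly) (hsep : β.charpoly.Separable) :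
    ∃ b : (Alg β)ˣ → ℂˣ, ∀ ε η, b ε * b η = cocycleRho τ d ε η * b (ε * η) := by
  obtain ⟨w, hw⟩ := hd.exists_eq_sub hτ hreg hsep
  -- With `w_ε = σ_ε⁻¹ w`, invariance and skew-symmetry give `⟨w - w_ε, w - w_{εη}⟩ = ⟨w, w_ε⟩ + ⟨w,
  -- w_η⟩ - ⟨w, w_{εη}⟩`.
  refine ⟨fun ε => Circle.toUnits (τ (2⁻¹ * form β w ((sigma ε).1.symm w))), fun ε η => ?_⟩
  dsimp only
  rw [cocycleRho, ← MonoidHom.map_mul, ← MonoidHom.map_mul, ← AddChar.map_add_eq_mul,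
    ← AddChar.map_add_eq_mul, hw, hw]
  have h1 : form β ((sigma ε).1.symm w) ((sigma (ε * η)).1.symm w) =
      form β w ((sigma η).1.symm w) := by
    rw [sigma_mul, ← (sigma ε).2]
    change form β ((sigma ε).1 ((sigma ε).1.symm w))
      ((sigma ε).1 ((sigma ε).1.symm ((sigma η).1.symm w))) = _
    simp only [LinearEquiv.apply_symm_apply]
  have h3 := form_self h2 form_skew w
  have h4 := form_skew w ((sigma ε).1.symm w)
  congr 2
  simp only [map_sub, LinearMap.sub_apply, h1, h3, h4]
  ring

end IsDisplacement

end Matrices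

/-! ### From an explicit cochain to the class in `H²` -/

section Cohomology

variable {G : Type u} [Group G]

theorem isTrivialClass_of_coboundary {c : G → G → ℂˣ} (a : G → ℂˣ)
    (h : ∀ g g', a g * a g' = c g g' * a (g * g')) : IsTrivialClass c := by
  have hmem : (fun p : G × G => ULift.up (Additive.ofMul (c p.1 p.2))) ∈
      coboundaries₂ (trivialUnits G) := by
    refine ⟨fun g => ULift.up (Additive.ofMul (a g)), funext fun p => ?_⟩
    -- The order of factors matches the differential `g • a(g') - a(gg') + a(g)` of a 1-cochain.
    have e : c p.1 p.2 = a p.2 / a (p.1 * p.2) * a p.1 := by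
      rw [div_mul_eq_mul_div, eq_div_iff_mul_eq', ← mul_comm (a p.1), h, mul_comm]
    rw [e]
    rfl
  exact ⟨coboundaries₂_le_cocycles₂ _ hmem, (H2π_eq_zero_iff _).2 hmem⟩

end Cohomology

end

end SchurMultiplier

open SchurMultiplier
theorem mainTheorem5 {F : Type*} [Field F] [Finite F] (hF : ringChar F ≠ 2)
    (τ : AddChar F Circle) (hτ : τ ≠ 1) {n : ℕ} (β : Matrix (Fin n) (Fin n) F)
    (hreg : minpoly F β = β.charpoly) (hsep : β.charpoly.Separable) :
    -- the objects in the claim exist, and are unique where they are said to be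
    (∃ (H : Type) (_ : AddCommGroup H) (_ : Module ℂ H)
      (π : Representation ℂ (Heisenberg τ (form β)) H), IsSchrodinger π) ∧
    (∀ (H : Type*) [AddCommGroup H] [Module ℂ H]
      (π : Representation ℂ (Heisenberg τ (form β)) H), IsSchrodinger π →
      (∃ T : Sp (form β) → (H ≃ₗ[ℂ] H), IsWeilFamily π T) ∧
      ∀ T : Sp (form β) → (H ≃ₗ[ℂ] H), IsWeilFamily π T →
        ∃! cT : Sp (form β) → Sp (form β) → ℂˣ, IsFactorSet T cT) ∧
    (∀ (ρ : AddChar (Alg β) ℂ) (s : VBeta β →ₗ[F] Matrix (Fin n) (Fin n) F) (hs : IsSplitting s),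
      ∃! d : (Alg β)ˣ → VBeta β, IsDisplacement τ ρ s hs d) ∧
    -- the class of the product of the two cocycles is trivial, for all choices
    ∀ (H : Type*) [AddCommGroup H] [Module ℂ H]
      (π : Representation ℂ (Heisenberg τ (form β)) H), IsSchrodinger π →
      ∀ T : Sp (form β) → (H ≃ₗ[ℂ] H), IsWeilFamily π T →
      ∀ cT : Sp (form β) → Sp (form β) → ℂˣ, IsFactorSet T cT →
      ∀ (ρ : AddChar (Alg β) ℂ) (s : VBeta β →ₗ[F] Matrix (Fin n) (Fin n) F) (hs : IsSplitting s)
        (d : (Alg β)ˣ → VBeta β), IsDisplacement τ ρ s hs d →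
        IsTrivialClass fun ε η : (Alg β)ˣ => cocycleRho τ d ε η * cT (sigma ε) (sigma η) := by
  have h2 : (2 : F) ≠ 0 := Ring.two_ne_zero hF
  have hB := form_nondegenerate hreg
  have : Finite (VBeta β) := Quotient.finite _
  refine ⟨exists_isSchrodinger τ (form β), fun H _ _ π hπ =>
    ⟨hπ.exists_isWeilFamily h2 form_skew hB hτ, fun T hT => hT.existsUnique_isFactorSet hπ⟩,
    fun ρ s hs => existsUnique_isDisplacement hτ hreg s hs,
    fun H _ _ π hπ T hT c hc ρ s hs d hd => ?_⟩
  obtain ⟨a, ha⟩ := hπ.exists_coboundary h2 form_skew hB hτ hT hc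
  obtain ⟨b, hb⟩ := hd.exists_coboundary h2 hτ hreg hsep
  refine isTrivialClass_of_coboundary (fun ε => b ε * a (sigma ε)) fun ε η => ?_
  rw [mul_mul_mul_comm, hb, ha, mul_mul_mul_comm, sigma_mul]
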